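/- Let $B$ be the butterfly graph, i.e. the graph on $5$ vertices formed by two triangles sharing exactly one vertex, and let $C_4$ be the cycle on $4$ vertices. For $j, s \ge 1$ let $K_{j\times s}$ be the complete multipartite graph with $j$ parts, each of size $s$. For graphs $G$ and $H$, the size multipartite Ramsey number $m_j(G,H)$ is the smallest positive integer $s$ (if one exists) such that every colouring of the edges of $K_{j\times s}$ with the colours red and blue contains a red copy of $G$ or a blue copy of $H$ (as a not necessarily induced subgraph). Then for every integer $j \ge 3$ the number $m_j(B, C_4)$ exists, and $$m_j(B, C_4) = \begin{cases} 4 & \text{if } j = 3,\\ 3 & \text{if } j = 4,\\ 2 & \text{if } j \in \{5,6\},\\ 1 & \text{if } j \ge 7.\end{cases}$$ -/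

import Mathlib

open scoped SimpleGraph

/-- The butterfly graph `B`: two triangles `0 1 2` and `0 3 4` sharing exactly the vertex `0`. -/
def butterflyGraph : SimpleGraph (Fin 5) :=
  SimpleGraph.fromEdgeSet {s(0, 1), s(0, 2), s(1, 2), s(0, 3), s(0, 4), s(3, 4)}

/-- `RamseyArrow K G H` is the arrow relation `K → (G, H)`: every colouring of the edges of `K`
with two colours contains a copy of `G` in red or a copy of `H` in blue. A colouring is a
partition of the edges of `K` into a red graph `R` and a blue graph `S` on the vertices of `K`;
copies are not necessarily induced. -/
def RamseyArrow {U V W : Type*} (K : SimpleGraph U) (G : SimpleGraph V) (H : SimpleGraph W) :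
    Prop :=
  ∀ R S : SimpleGraph U, R ⊔ S = K → Disjoint R S → G ⊑ R ∨ H ⊑ S

/-- `IsSizeMultipartiteRamsey j G H m` says that the size multipartite Ramsey number `m_j(G, H)`
exists and is equal to `m`: the least positive integer `s` with `K_{j × s} → (G, H)`, where
`K_{j × s}` is the complete multipartite graph with `j` parts of size `s`, is `m`. -/
def IsSizeMultipartiteRamsey {V W : Type*} (j : ℕ) (G : SimpleGraph V) (H : SimpleGraph W)
    (m : ℕ) : Prop :=
  IsLeast {s : ℕ | 0 < s ∧ RamseyArrow (SimpleGraph.completeEquipartiteGraph j s) G H} m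

/-! The arrow relation passes to larger `j` and `s`, so seven cases suffice: it holds for `K_{7×1}`,
`K_{5×2}`, `K_{4×3}`, `K_{3×4}` and fails for `K_{6×1}`, `K_{4×2}`, `K_{3×3}`. The failures are
explicit colourings, fed to `not_ramseyArrow_of_blue`.

The four positive cases are backtracking searches run by the kernel. Edges are coloured one at a
time, and a branch closes once a red butterfly, a blue four-cycle or a pattern excluded by symmetry
is complete. The symmetry is that parts and their vertices can be permuted so that the blue
neighbourhood of vertex `0` is sorted (`exists_perm_sorted`). Soundness is `not_refutes`: a good
colouring would trace a branch that never closes. For speed, a set of coloured edges is the bit set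
of a number, and all patterns of a level are tested by a few operations on one large number. -/

/-! ### Packed arithmetic -/

/-- The number whose base `2 ^ w` digits are the entries of `l`. -/
def packDigits (w : ℕ) (l : List ℕ) : ℕ :=
  l.foldr (fun x a => Nat.add x (Nat.mul (2 ^ w) a)) 0

/-- The number with `l.length` digits in base `2 ^ w`, all equal to one. -/
def packOnes (w : ℕ) (l : List ℕ) : ℕ :=
  l.foldr (fun _ a => Nat.add 1 (Nat.mul (2 ^ w) a)) 0

@[simp] theorem packDigits_nil (w : ℕ) : packDigits w [] = 0 := rfl

@[simp] theorem packDigits_cons (w x : ℕ) (l : List ℕ) :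
    packDigits w (x :: l) = x + 2 ^ w * packDigits w l := rfl

@[simp] theorem packOnes_nil (w : ℕ) : packOnes w [] = 0 := rfl

@[simp] theorem packOnes_cons (w x : ℕ) (l : List ℕ) :
    packOnes w (x :: l) = 1 + 2 ^ w * packOnes w l := rfl

theorem land_add_two_pow_mul {w a c : ℕ} (ha : a < 2 ^ w) (hc : c < 2 ^ w) (b d : ℕ) :
    (a + 2 ^ w * b) &&& (c + 2 ^ w * d) = (a &&& c) + 2 ^ w * (b &&& d) := by
  have hac : a &&& c < 2 ^ w := lt_of_le_of_lt Nat.and_le_left ha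
  apply Nat.eq_of_testBit_eq
  intro i
  rw [Nat.testBit_and, add_comm a, add_comm c, add_comm (a &&& c),
    Nat.testBit_two_pow_mul_add _ ha, Nat.testBit_two_pow_mul_add _ hc,
    Nat.testBit_two_pow_mul_add _ hac]
  split <;> simp

/-- Multiplying by `packOnes` copies `c` into every digit without carries, so a single `&&&` acts
digit by digit. -/
theorem land_packDigits {w c : ℕ} (hc : c < 2 ^ w) (l : List ℕ) (hl : ∀ x ∈ l, x < 2 ^ w) :
    packDigits w l &&& (packOnes w l * c) = packDigits w (l.map (· &&& c)) := by
  induction l with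
  | nil => simp
  | cons x l ih =>
    simp only [List.mem_cons, forall_eq_or_imp] at hl
    simp only [packDigits_cons, packOnes_cons, List.map_cons]
    rw [add_mul, one_mul, mul_assoc, land_add_two_pow_mul hl.1 hc, ih hl.2]

/-- If all digits are positive and at most `2 ^ N`, subtracting them from `2 ^ N` clears the
digit bit `N` everywhere. -/
theorem land_sub_packDigits {N : ℕ} (l : List ℕ) (hl : ∀ x ∈ l, 0 < x ∧ x ≤ 2 ^ N) :
    packDigits (N + 1) l ≤ 2 ^ N * packOnes (N + 1) l ∧
    (2 ^ N * packOnes (N + 1) l) &&& (2 ^ N * packOnes (N + 1) l - packDigits (N + 1) l) = 0 := by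
  induction l with
  | nil => simp
  | cons x l ih =>
    simp only [List.mem_cons, forall_eq_or_imp] at hl
    obtain ⟨ih₁, ih₂⟩ := ih hl.2
    obtain ⟨hx₀, hx₁⟩ := hl.1
    have hp : 2 ^ N < 2 ^ (N + 1) := Nat.pow_lt_pow_right (by norm_num) (by omega)
    simp only [packDigits_cons, packOnes_cons]
    generalize packDigits (N + 1) l = P at *
    generalize packOnes (N + 1) l = O at *
    have e₁ : 2 ^ N * (1 + 2 ^ (N + 1) * O) = 2 ^ N + 2 ^ (N + 1) * (2 ^ N * O) := by ring
    have hle : 2 ^ (N + 1) * P ≤ 2 ^ (N + 1) * (2 ^ N * O) := Nat.mul_le_mul_left _ ih₁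
    -- There is no borrow between digits, since `x ≤ 2 ^ N` and `P ≤ 2 ^ N * O`.
    have e₂ : 2 ^ N + 2 ^ (N + 1) * (2 ^ N * O) - (x + 2 ^ (N + 1) * P) =
        (2 ^ N - x) + 2 ^ (N + 1) * (2 ^ N * O - P) := by
      rw [Nat.mul_sub]
      omega
    refine ⟨by rw [e₁]; omega, ?_⟩
    rw [e₁, e₂, land_add_two_pow_mul hp (by omega), ih₂]
    simp only [mul_zero, add_zero]
    rw [Nat.and_comm, Nat.and_two_pow, Nat.testBit_lt_two_pow (by omega)]
    simp

/-- The digits of `P` in base `2 ^ (N + 1)` all meet the bit set `c`, where `O` has the digits one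
and `H` the digits `2 ^ N`. -/
def allMeet (P O H c : ℕ) : Bool :=
  Nat.beq (Nat.land H (Nat.sub H (Nat.land P (Nat.mul O c)))) 0

/-- The direction that soundness needs: a failed test is caused by an actual pattern disjoint from
`c`, that is, one with all bits assigned. -/
theorem exists_land_eq_zero_of_allMeet {N c : ℕ} {l : List ℕ} (hc : c < 2 ^ N)
    (hl : ∀ x ∈ l, x < 2 ^ N)
    (h : allMeet (packDigits (N + 1) l) (packOnes (N + 1) l) (Nat.mul (2 ^ N) (packOnes (N + 1) l))
      c = false) : ∃ p ∈ l, p &&& c = 0 := by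
  by_contra! hcon
  have hp : 2 ^ N < 2 ^ (N + 1) := Nat.pow_lt_pow_right (by norm_num) (by omega)
  have key := (land_sub_packDigits (N := N) (l.map (· &&& c)) (by
    intro x hx
    obtain ⟨y, hy, rfl⟩ := List.mem_map.1 hx
    exact ⟨Nat.pos_of_ne_zero (hcon y hy), (Nat.and_le_left.trans (hl y hy).le)⟩)).2
  have e : packOnes (N + 1) (l.map (· &&& c)) = packOnes (N + 1) l := by
    simp [packOnes, List.foldr_map]
  rw [e, ← land_packDigits (hc.trans hp) l (fun x hx => (hl x hx).trans hp)] at key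
  have : allMeet (packDigits (N + 1) l) (packOnes (N + 1) l)
      (Nat.mul (2 ^ N) (packOnes (N + 1) l)) c = true := by
    unfold allMeet
    rw [Nat.beq_eq]
    exact key
  exact absurd (h.symm.trans this) (by simp)

/-! ### Exhaustive search -/

/-- One step of the search: the two bits, one of which is assigned, each with the packed list of
the forbidden patterns that this assignment may complete. -/
structure SearchLevel where
  bit₀ : ℕ
  pack₀ : ℕ
  ones₀ : ℕ
  high₀ : ℕ
  bit₁ : ℕ
  pack₁ : ℕ
  ones₁ : ℕ
  high₁ : ℕ

/-- The level that assigns the bit `2 * k` or the bit `2 * k + 1`, with lists of forbidden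
patterns for these two cases. -/
def SearchLevel.ofPatterns (N k : ℕ) (l₀ l₁ : List ℕ) : SearchLevel :=
  ⟨2 ^ (2 * k), packDigits (N + 1) l₀, packOnes (N + 1) l₀,
    Nat.mul (2 ^ N) (packOnes (N + 1) l₀), 2 ^ (2 * k + 1), packDigits (N + 1) l₁,
    packOnes (N + 1) l₁, Nat.mul (2 ^ N) (packOnes (N + 1) l₁)⟩

/-- `refutes ls c` holds if every way of assigning one of the two bits of each level completes
a forbidden pattern; `c` is the set of the bits that are not yet assigned. It is written with
recursors so that the kernel evaluates it fast. -/
noncomputable def refutes (ls : List SearchLevel) : ℕ → Bool :=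
  List.rec (motive := fun _ => ℕ → Bool) (fun _ => false)
    (fun l _ ih c => SearchLevel.rec (motive := fun _ => Bool) (fun b₀ p₀ o₀ h₀ b₁ p₁ o₁ h₁ =>
      Bool.rec (motive := fun _ => Bool) false
        (Bool.rec (motive := fun _ => Bool) true (ih (Nat.xor c b₁))
          (allMeet p₁ o₁ h₁ (Nat.xor c b₁)))
        (Bool.rec (motive := fun _ => Bool) true (ih (Nat.xor c b₀))
          (allMeet p₀ o₀ h₀ (Nat.xor c b₀))))
      l) ls

/-- Both choices must be refuted, each either at once by a completed pattern or by the remaining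
levels. -/
theorem refutes_cons (l : SearchLevel) (ls : List SearchLevel) (c : ℕ) :
    refutes (l :: ls) c =
      ((!allMeet l.pack₀ l.ones₀ l.high₀ (c ^^^ l.bit₀) || refutes ls (c ^^^ l.bit₀)) &&
        (!allMeet l.pack₁ l.ones₁ l.high₁ (c ^^^ l.bit₁) || refutes ls (c ^^^ l.bit₁))) := by
  rcases l with ⟨b₀, p₀, o₀, h₀, b₁, p₁, o₁, h₁⟩
  change Bool.rec (motive := fun _ => Bool) false
        (Bool.rec (motive := fun _ => Bool) true (refutes ls (c ^^^ b₁))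
          (allMeet p₁ o₁ h₁ (c ^^^ b₁)))
        (Bool.rec (motive := fun _ => Bool) true (refutes ls (c ^^^ b₀))
          (allMeet p₀ o₀ h₀ (c ^^^ b₀))) = _
  dsimp only
  cases allMeet p₀ o₀ h₀ (c ^^^ b₀) <;> cases allMeet p₁ o₁ h₁ (c ^^^ b₁) <;>
    cases refutes ls (c ^^^ b₀) <;> cases refutes ls (c ^^^ b₁) <;> rfl

/-- All members of the bit set `p` satisfy `val`. -/
def BitsHold (val : ℕ → Prop) (p : ℕ) : Prop := ∀ i, p.testBit i = true → val i

theorem bitsHold_lor {val : ℕ → Prop} {p q : ℕ} :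
    BitsHold val (p ||| q) ↔ BitsHold val p ∧ BitsHold val q := by
  simp only [BitsHold, Nat.testBit_or, Bool.or_eq_true]
  grind

theorem bitsHold_two_pow {val : ℕ → Prop} {i : ℕ} : BitsHold val (2 ^ i) ↔ val i := by
  simp [BitsHold, Nat.testBit_two_pow]

/-- Follow the branch dictated by `val`. Only true bits are assigned along it, so no forbidden
pattern is ever completed and the levels run out. How patterns are distributed over levels plays no
role. -/
theorem not_refutes {val : ℕ → Prop} {N : ℕ} (ls : List SearchLevel)
    (hls : ∀ l ∈ ls, ∃ k l₀ l₁, l = SearchLevel.ofPatterns N k l₀ l₁ ∧ 2 * k + 1 < N ∧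
      (val (2 * k) ∨ val (2 * k + 1)) ∧ ∀ p, p ∈ l₀ ∨ p ∈ l₁ → p < 2 ^ N ∧ ¬ BitsHold val p)
    (c : ℕ) (hc : c < 2 ^ N) (hcval : ∀ i < N, c.testBit i = false → val i) :
    refutes ls c = false := by
  induction ls generalizing c with
  | nil => rfl
  | cons l ls ih =>
    simp only [List.mem_cons, forall_eq_or_imp] at hls
    obtain ⟨⟨k, l₀, l₁, rfl, hk, hval, hpat⟩, hls⟩ := hls
    have step : ∀ i ps, i < N → val i → (∀ p ∈ ps, p < 2 ^ N ∧ ¬ BitsHold val p) →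
        (!allMeet (packDigits (N + 1) ps) (packOnes (N + 1) ps)
          (Nat.mul (2 ^ N) (packOnes (N + 1) ps)) (c ^^^ 2 ^ i) || refutes ls (c ^^^ 2 ^ i)) =
          false := by
      intro j ps hj hvj hps
      have hc' : c ^^^ 2 ^ j < 2 ^ N :=
        Nat.xor_lt_two_pow hc (Nat.pow_lt_pow_right (by norm_num) hj)
      have hcval' : ∀ i < N, (c ^^^ 2 ^ j).testBit i = false → val i := by
        intro i hi h
        rw [Nat.testBit_xor, Nat.testBit_two_pow] at h
        by_cases hji : j = i
        · exact hji ▸ hvj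
        · exact hcval i hi (by simpa [hji] using h)
      rw [Bool.or_eq_false_iff]
      refine ⟨?_, ih hls _ hc' hcval'⟩
      by_contra hne
      obtain ⟨p, hp, hp₀⟩ := exists_land_eq_zero_of_allMeet hc' (fun x hx => (hps x hx).1)
        (by simpa using hne)
      refine (hps p hp).2 fun i hi => hcval' i ?_ ?_
      -- Bits from `N` on are missing from `c` without having been assigned; `p < 2 ^ N` keeps them
      -- out of the pattern.
      · by_contra hi'
        have := Nat.testBit_lt_two_pow (lt_of_lt_of_le (hps p hp).1
          (Nat.pow_le_pow_right (by norm_num) (not_lt.1 hi')))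
        simp [this] at hi
      · have := congrArg (fun t => t.testBit i) hp₀
        simpa [hi] using this
    rw [refutes_cons, Bool.and_eq_false_iff]
    exact hval.imp
      (fun h => step _ _ (by omega) h fun p hp => hpat p (Or.inl hp))
      (fun h => step _ _ hk h fun p hp => hpat p (Or.inr hp))

/-- The levels `k, …, k + 2 ^ d - 1`, as far as they are less than `m`, where each pattern is put
on the level of its highest bit. -/
def searchLevels (N m : ℕ) : ℕ → ℕ → List ℕ → List SearchLevel
  | 0, k, ps => bif Nat.ble m k then [] else
      [.ofPatterns N k (ps.filter fun p => !Nat.ble (2 ^ (2 * k + 1)) p)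
        (ps.filter fun p => Nat.ble (2 ^ (2 * k + 1)) p)]
  | d + 1, k, ps =>
    searchLevels N m d k (ps.filter fun p => !Nat.ble (2 ^ (2 * (k + 2 ^ d))) p) ++
      searchLevels N m d (k + 2 ^ d) (ps.filter fun p => Nat.ble (2 ^ (2 * (k + 2 ^ d))) p)

/-- Sorting patterns by highest bit only serves speed; soundness needs no more than that each
pattern comes from `ps`. -/
theorem mem_searchLevels {N m d k : ℕ} {ps : List ℕ} {l : SearchLevel}
    (h : l ∈ searchLevels N m d k ps) : ∃ k l₀ l₁, l = SearchLevel.ofPatterns N k l₀ l₁ ∧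
      k < m ∧ ∀ p, p ∈ l₀ ∨ p ∈ l₁ → p ∈ ps := by
  induction d generalizing k ps with
  | zero =>
    rw [searchLevels] at h
    cases hb : Nat.ble m k with
    | true => simp [hb] at h
    | false =>
      rw [hb, cond_false, List.mem_singleton] at h
      refine ⟨k, _, _, h, not_le.1 fun h => ?_,
        fun p hp => hp.elim List.mem_of_mem_filter List.mem_of_mem_filter⟩
      simp [Nat.ble_eq_true_of_le h] at hb
  | succ d ih =>
    rcases List.mem_append.1 h with h | h <;> obtain ⟨k, l₀, l₁, e, hk, hp⟩ := ih h <;>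
      exact ⟨k, l₀, l₁, e, hk, fun p h => List.mem_of_mem_filter (hp p h)⟩

/-! ### Forbidden patterns of two-coloured complete multipartite graphs -/

/-- The first position of the edge `{u, v}` in `es`, or the length of `es`. -/
def edgeIndex (es : List (ℕ × ℕ)) (u v : ℕ) : ℕ :=
  es.foldr (fun e k => bif (Nat.beq e.1 u && Nat.beq e.2 v) || (Nat.beq e.1 v && Nat.beq e.2 u)
    then 0 else Nat.succ k) 0

/-- The bit standing for: the edge `{u, v}` has colour `c`, where red is `0` and blue is `1`. -/
def edgeBit (es : List (ℕ × ℕ)) (c u v : ℕ) : ℕ := 2 ^ (2 * edgeIndex es u v + c)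

/-- The truth value of the statement that a bit stands for. -/
def bitVal (es : List (ℕ × ℕ)) (red blue : ℕ → ℕ → Prop) (i : ℕ) : Prop :=
  ∃ e, es[i / 2]? = some e ∧ if i % 2 = 0 then red e.1 e.2 else blue e.1 e.2

theorem edgeIndex_le (es : List (ℕ × ℕ)) (u v : ℕ) : edgeIndex es u v ≤ es.length := by
  induction es with
  | nil => simp [edgeIndex]
  | cons e es ih =>
    simp only [edgeIndex, List.foldr_cons, List.length_cons] at ih ⊢
    cases (Nat.beq e.1 u && Nat.beq e.2 v) || (Nat.beq e.1 v && Nat.beq e.2 u) <;> simp [ih]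

/-- The `+ 2` makes room for the two dummy bits of a pair that is not listed, whose index is
`es.length`. -/
theorem edgeBit_lt {es : List (ℕ × ℕ)} {c : ℕ} (hc : c < 2) (u v : ℕ) :
    edgeBit es c u v < 2 ^ (2 * es.length + 2) :=
  Nat.pow_lt_pow_right (by norm_num) (by have := edgeIndex_le es u v; omega)

theorem getElem?_edgeIndex {es : List (ℕ × ℕ)} {u v : ℕ} {e : ℕ × ℕ}
    (h : es[edgeIndex es u v]? = some e) : e = (u, v) ∨ e = (v, u) := by
  induction es with
  | nil => simp at h
  | cons e' es ih =>
    simp only [edgeIndex, List.foldr_cons] at ih h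
    cases hb : (Nat.beq e'.1 u && Nat.beq e'.2 v) || (Nat.beq e'.1 v && Nat.beq e'.2 u) with
    | false =>
      rw [hb] at h
      exact ih (by simpa using h)
    | true =>
      rw [hb] at h
      simp only [cond_true, List.getElem?_cons_zero, Option.some.injEq] at h
      subst h
      simpa [Prod.ext_iff] using hb

section Colouring

variable {es : List (ℕ × ℕ)} {red blue : ℕ → ℕ → Prop}

/-- For an unlisted pair the look-up in `bitVal` fails and the bit is false, so a bit that holds
belongs to a listed edge, in one of its two orientations. -/
theorem red_of_bitsHold (hred : ∀ u v, red u v → red v u) {u v : ℕ}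
    (h : BitsHold (bitVal es red blue) (edgeBit es 0 u v)) : red u v := by
  obtain ⟨e, he, hc⟩ := bitsHold_two_pow.1 h
  rw [show (2 * edgeIndex es u v + 0) / 2 = edgeIndex es u v by omega] at he
  rw [if_pos (by omega)] at hc
  rcases getElem?_edgeIndex he with rfl | rfl
  · exact hc
  · exact hred _ _ hc

theorem blue_of_bitsHold (hblue : ∀ u v, blue u v → blue v u) {u v : ℕ}
    (h : BitsHold (bitVal es red blue) (edgeBit es 1 u v)) : blue u v := by
  obtain ⟨e, he, hc⟩ := bitsHold_two_pow.1 h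
  rw [show (2 * edgeIndex es u v + 1) / 2 = edgeIndex es u v by omega] at he
  rw [if_neg (by omega)] at hc
  rcases getElem?_edgeIndex he with rfl | rfl
  · exact hc
  · exact hblue _ _ hc

end Colouring

/-- The unions of the second components of the pairs of entries of a list that are related
by `f`. -/
def pairUnions (f : ℕ → ℕ → Bool) : List (ℕ × ℕ) → List ℕ
  | [] => []
  | p :: l => (l.filter fun q => f p.1 q.1).map (fun q => Nat.lor p.2 q.2) ++ pairUnions f l

theorem exists_of_mem_pairUnions {f : ℕ → ℕ → Bool} {l : List (ℕ × ℕ)} {m : ℕ}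
    (h : m ∈ pairUnions f l) : ∃ p ∈ l, ∃ q ∈ l, f p.1 q.1 = true ∧ m = p.2 ||| q.2 := by
  induction l with
  | nil => simp [pairUnions] at h
  | cons p l ih =>
    rcases List.mem_append.1 h with h | h
    · obtain ⟨q, hq, rfl⟩ := List.mem_map.1 h
      obtain ⟨hq, hf⟩ := List.mem_filter.1 hq
      exact ⟨p, by simp, q, by simp [hq], hf, rfl⟩
    · obtain ⟨p', hp', q, hq, h⟩ := ih h
      exact ⟨p', by simp [hp'], q, by simp [hq], h⟩

/-- The blue four-cycles in the complete multipartite graph on `n` vertices in which the parts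
are intervals of length `s`. -/
def blueFourCycles (es : List (ℕ × ℕ)) (n s : ℕ) : List ℕ :=
  (List.range n).flatMap fun x => (List.range n).flatMap fun z => bif Nat.ble z x then [] else
    pairUnions (fun y w => !Nat.beq y w) <| (List.range n).flatMap fun y =>
      bif Nat.ble y x || Nat.beq (x / s) (y / s) || Nat.beq (y / s) (z / s) then [] else
        [(y, Nat.lor (edgeBit es 1 x y) (edgeBit es 1 y z))]

/-- The red triangles containing `x`, each with the set of its other two vertices. -/
def redTriangles (es : List (ℕ × ℕ)) (n s x : ℕ) : List (ℕ × ℕ) :=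
  (List.range n).flatMap fun y => bif Nat.beq (x / s) (y / s) then [] else
    (List.range n).flatMap fun z =>
      bif Nat.ble y z || Nat.beq (x / s) (z / s) || Nat.beq (y / s) (z / s) then [] else
        [(Nat.lor (2 ^ y) (2 ^ z),
          Nat.lor (edgeBit es 0 x y) (Nat.lor (edgeBit es 0 x z) (edgeBit es 0 y z)))]

/-- The red butterflies. -/
def redButterflies (es : List (ℕ × ℕ)) (n s : ℕ) : List ℕ :=
  (List.range n).flatMap fun x =>
    pairUnions (fun p q => Nat.beq (Nat.land p q) 0) (redTriangles es n s x)

/-- The patterns around vertex `0` that can be excluded by symmetry. -/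
def unsortedStars (es : List (ℕ × ℕ)) (n s : ℕ) : List ℕ :=
  (List.range n).flatMap fun x => bif Nat.blt x s then [] else
    (bif Nat.beq ((x + 1) % s) 0 then [] else
      [Nat.lor (edgeBit es 0 0 x) (edgeBit es 1 0 (x + 1))]) ++
    (bif Nat.ble n (x + s) then [] else
      [Nat.lor (edgeBit es 0 0 x) (edgeBit es 1 0 (x + s))])

def forbiddenPatterns (es : List (ℕ × ℕ)) (n s : ℕ) : List ℕ :=
  unsortedStars es n s ++ (redButterflies es n s ++ blueFourCycles es n s)

/-- Every red-blue colouring of the edges `es` contains a forbidden pattern. Here `2 ^ d` has to be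
at least the number of edges. -/
noncomputable def colouringRefuted (es : List (ℕ × ℕ)) (n s d : ℕ) : Bool :=
  refutes (searchLevels (2 * es.length + 2) es.length d 0 (forbiddenPatterns es n s))
    (2 ^ (2 * es.length + 2) - 1)

/-- Each family of patterns is ruled out by one of the last four hypotheses. Neither `es` nor the
pattern list has to be complete: an omission could only make the search fail. -/
theorem false_of_colouringRefuted {es : List (ℕ × ℕ)} {n s d : ℕ} {red blue : ℕ → ℕ → Prop}
    (href : colouringRefuted es n s d = true)
    (hred : ∀ u v, red u v → red v u) (hblue : ∀ u v, blue u v → blue v u)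
    (htot : ∀ e ∈ es, red e.1 e.2 ∨ blue e.1 e.2)
    (hcycle : ∀ x y z w, x ≠ z → y ≠ w → blue x y → blue y z → blue x w → blue w z → False)
    (hbutterfly : ∀ x y z y' z', y ≠ y' → y ≠ z' → z ≠ y' → z ≠ z' → red x y → red x z →
      red y z → red x y' → red x z' → red y' z' → False)
    (hrow : ∀ x, s ≤ x → (x + 1) % s ≠ 0 → red 0 x → blue 0 (x + 1) → False)
    (hpart : ∀ x, s ≤ x → x + s < n → red 0 x → blue 0 (x + s) → False) : False := by
  have hpat : ∀ p ∈ forbiddenPatterns es n s, p < 2 ^ (2 * es.length + 2) ∧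
      ¬ BitsHold (bitVal es red blue) p := by
    intro p hp
    have h₀ := fun u v => edgeBit_lt (es := es) (c := 0) (by norm_num) u v
    have h₁ := fun u v => edgeBit_lt (es := es) (c := 1) (by norm_num) u v
    have hr := fun u v => red_of_bitsHold (es := es) (blue := blue) hred (u := u) (v := v)
    have hb := fun u v => blue_of_bitsHold (es := es) (red := red) hblue (u := u) (v := v)
    rcases List.mem_append.1 hp with hp | hp
    · obtain ⟨x, -, hx⟩ := List.mem_flatMap.1 hp
      cases hxs : Nat.blt x s with
      | true => simp [hxs] at hx
      | false =>
        have hsx : s ≤ x := by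
          by_contra hcon
          have : Nat.blt x s = true := by simpa [Nat.blt_eq] using hcon
          simp [hxs] at this
        rw [hxs, cond_false] at hx
        rcases List.mem_append.1 hx with hx | hx
        · cases hm : Nat.beq ((x + 1) % s) 0 with
          | true => simp [hm] at hx
          | false =>
            rw [hm, cond_false, List.mem_singleton] at hx
            subst hx
            refine ⟨Nat.or_lt_two_pow (h₀ _ _) (h₁ _ _), fun h => ?_⟩
            obtain ⟨ha, hb'⟩ := bitsHold_lor.1 h
            exact hrow x hsx (fun h => by simp [h] at hm) (hr _ _ ha) (hb _ _ hb')
        · cases hm : Nat.ble n (x + s) with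
          | true => simp [hm] at hx
          | false =>
            rw [hm, cond_false, List.mem_singleton] at hx
            subst hx
            refine ⟨Nat.or_lt_two_pow (h₀ _ _) (h₁ _ _), fun h => ?_⟩
            obtain ⟨ha, hb'⟩ := bitsHold_lor.1 h
            refine hpart x hsx (not_le.1 fun h => ?_) (hr _ _ ha) (hb _ _ hb')
            simp [Nat.ble_eq_true_of_le h] at hm
    rcases List.mem_append.1 hp with hp | hp
    · obtain ⟨x, -, hx⟩ := List.mem_flatMap.1 hp
      obtain ⟨p₁, hp₁, p₂, hp₂, hf, rfl⟩ := exists_of_mem_pairUnions hx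
      have htri : ∀ q ∈ redTriangles es n s x, ∃ y z, q = (2 ^ y ||| 2 ^ z,
          edgeBit es 0 x y ||| (edgeBit es 0 x z ||| edgeBit es 0 y z)) := by
        intro q hq
        obtain ⟨y, -, hy⟩ := List.mem_flatMap.1 hq
        cases hxy : Nat.beq (x / s) (y / s) with
        | true => simp [hxy] at hy
        | false =>
          rw [hxy, cond_false] at hy
          obtain ⟨z, -, hz⟩ := List.mem_flatMap.1 hy
          cases hc : Nat.ble y z || Nat.beq (x / s) (z / s) || Nat.beq (y / s) (z / s) with
          | true => simp [hc] at hz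
          | false =>
            rw [hc, cond_false, List.mem_singleton] at hz
            exact ⟨y, z, hz⟩
      obtain ⟨y, z, rfl⟩ := htri _ hp₁
      obtain ⟨y', z', rfl⟩ := htri _ hp₂
      dsimp only at hf ⊢
      refine ⟨Nat.or_lt_two_pow (Nat.or_lt_two_pow (h₀ _ _) (Nat.or_lt_two_pow (h₀ _ _) (h₀ _ _)))
        (Nat.or_lt_two_pow (h₀ _ _) (Nat.or_lt_two_pow (h₀ _ _) (h₀ _ _))), fun h => ?_⟩
      simp only [bitsHold_lor] at h
      obtain ⟨⟨a, b, c⟩, a', b', c'⟩ := h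
      -- Disjoint vertex masks mean that the two triangles share only `x`; reading bits `y` and `z`
      -- gives the four inequalities.
      have hdis : ∀ i, ((2 ^ y ||| 2 ^ z) &&& (2 ^ y' ||| 2 ^ z')).testBit i = false := by
        rw [show (2 ^ y ||| 2 ^ z) &&& (2 ^ y' ||| 2 ^ z') = 0 from Nat.eq_of_beq_eq_true hf]
        simp
      simp only [Nat.testBit_and, Nat.testBit_or, Nat.testBit_two_pow] at hdis
      have hdy := hdis y
      have hdz := hdis z
      simp only [decide_true, Bool.true_or, Bool.or_true, Bool.true_and, Bool.or_eq_false_iff,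
        decide_eq_false_iff_not] at hdy hdz
      exact hbutterfly x y z y' z' (Ne.symm hdy.1) (Ne.symm hdy.2) (Ne.symm hdz.1)
        (Ne.symm hdz.2) (hr _ _ a) (hr _ _ b) (hr _ _ c) (hr _ _ a') (hr _ _ b') (hr _ _ c')
    · obtain ⟨x, -, hx⟩ := List.mem_flatMap.1 hp
      obtain ⟨z, -, hz⟩ := List.mem_flatMap.1 hx
      cases hzx : Nat.ble z x with
      | true => simp [hzx] at hz
      | false =>
        have hne : x ≠ z := by
          rintro rfl
          simp [Nat.ble_eq_true_of_le le_rfl] at hzx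
        rw [hzx, cond_false] at hz
        obtain ⟨p₁, hp₁, p₂, hp₂, hf, rfl⟩ := exists_of_mem_pairUnions hz
        have hpath : ∀ q ∈ ((List.range n).flatMap fun y =>
            bif Nat.ble y x || Nat.beq (x / s) (y / s) || Nat.beq (y / s) (z / s) then [] else
              [(y, Nat.lor (edgeBit es 1 x y) (edgeBit es 1 y z))]),
            ∃ y, q = (y, edgeBit es 1 x y ||| edgeBit es 1 y z) := by
          intro q hq
          obtain ⟨y, -, hy⟩ := List.mem_flatMap.1 hq
          cases hc : Nat.ble y x || Nat.beq (x / s) (y / s) || Nat.beq (y / s) (z / s) with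
          | true => simp [hc] at hy
          | false =>
            rw [hc, cond_false, List.mem_singleton] at hy
            exact ⟨y, hy⟩
        obtain ⟨y, rfl⟩ := hpath _ hp₁
        obtain ⟨w, rfl⟩ := hpath _ hp₂
        dsimp only at hf ⊢
        refine ⟨Nat.or_lt_two_pow (Nat.or_lt_two_pow (h₁ _ _) (h₁ _ _))
          (Nat.or_lt_two_pow (h₁ _ _) (h₁ _ _)), fun h => ?_⟩
        simp only [bitsHold_lor] at h
        refine hcycle x y z w hne ?_ (hb _ _ h.1.1) (hb _ _ h.1.2) (hb _ _ h.2.1) (hb _ _ h.2.2)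
        rintro rfl
        simp at hf
  have := not_refutes (val := bitVal es red blue) (N := 2 * es.length + 2)
    (searchLevels (2 * es.length + 2) es.length d 0 (forbiddenPatterns es n s))
    (fun l hl => by
      obtain ⟨k, l₀, l₁, e, hk, hp⟩ := mem_searchLevels hl
      refine ⟨k, l₀, l₁, e, by omega, ?_, fun p h => hpat p (hp p h)⟩
      refine (htot es[k] (List.getElem_mem hk)).imp (fun h => ⟨es[k], ?_, ?_⟩)
        (fun h => ⟨es[k], ?_, ?_⟩)
      · rw [show 2 * k / 2 = k by omega]
        exact List.getElem?_eq_getElem hk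
      · rwa [if_pos (by omega)]
      · rw [show (2 * k + 1) / 2 = k by omega]
        exact List.getElem?_eq_getElem hk
      · rwa [if_neg (by omega)])
    -- Initially every bit is unassigned, so the condition on assigned bits is vacuous.
    (2 ^ (2 * es.length + 2) - 1) (Nat.sub_lt (by positivity) (by norm_num))
    (fun i hi h => by simp [hi] at h)
  simp [colouringRefuted, this] at href

/-! ### Copies of the four-cycle and of the butterfly -/

section Copies

variable {V : Type*} {G : SimpleGraph V}

theorem cycleGraph_four_isContained_iff : SimpleGraph.cycleGraph 4 ⊑ G ↔
    ∃ x y z w, x ≠ z ∧ y ≠ w ∧ G.Adj x y ∧ G.Adj y z ∧ G.Adj x w ∧ G.Adj w z := by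
  constructor
  · rintro ⟨f⟩
    have h : ∀ i j : Fin 4, (SimpleGraph.cycleGraph 4).Adj i j → G.Adj (f i) (f j) :=
      fun i j hij => f.toHom.map_adj hij
    exact ⟨f 0, f 1, f 2, f 3, f.injective.ne (by decide), f.injective.ne (by decide),
      h _ _ (SimpleGraph.cycleGraph_adj.2 (by decide)),
      h _ _ (SimpleGraph.cycleGraph_adj.2 (by decide)),
      h _ _ (SimpleGraph.cycleGraph_adj.2 (by decide)),
      h _ _ (SimpleGraph.cycleGraph_adj.2 (by decide))⟩
  · rintro ⟨x, y, z, w, hxz, hyw, hxy, hyz, hxw, hwz⟩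
    refine ⟨SimpleGraph.Hom.toCopy ⟨![x, y, z, w], ?_⟩ ?_⟩
    · intro i j hij
      rw [SimpleGraph.cycleGraph_adj] at hij
      fin_cases i <;> fin_cases j <;>
        first
        | exact absurd hij (by decide)
        | simp [hxy, hyz, hxw, hwz, hxy.symm, hyz.symm, hxw.symm, hwz.symm]
    · intro i j hij
      have := hxy.ne
      have := hyz.ne
      have := hxw.ne
      have := hwz.ne
      fin_cases i <;> fin_cases j <;> simp at hij ⊢ <;> grind

/-- Only the four inequalities across the two triangles are needed; adjacency gives the others. -/
theorem butterflyGraph_isContained_iff : butterflyGraph ⊑ G ↔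
    ∃ x y z y' z', y ≠ y' ∧ y ≠ z' ∧ z ≠ y' ∧ z ≠ z' ∧ G.Adj x y ∧ G.Adj x z ∧ G.Adj y z ∧
      G.Adj x y' ∧ G.Adj x z' ∧ G.Adj y' z' := by
  constructor
  · rintro ⟨f⟩
    have h : ∀ i j : Fin 5, butterflyGraph.Adj i j → G.Adj (f i) (f j) :=
      fun i j hij => f.toHom.map_adj hij
    exact ⟨f 0, f 1, f 2, f 3, f 4, f.injective.ne (by decide), f.injective.ne (by decide),
      f.injective.ne (by decide), f.injective.ne (by decide),
      h _ _ (by simp [butterflyGraph]), h _ _ (by simp [butterflyGraph]),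
      h _ _ (by simp [butterflyGraph]), h _ _ (by simp [butterflyGraph]),
      h _ _ (by simp [butterflyGraph]), h _ _ (by simp [butterflyGraph])⟩
  · rintro ⟨x, y, z, y', z', h₁, h₂, h₃, h₄, a, b, c, a', b', c'⟩
    refine ⟨SimpleGraph.Hom.toCopy ⟨![x, y, z, y', z'], ?_⟩ ?_⟩
    · intro i j hij
      rw [butterflyGraph, SimpleGraph.fromEdgeSet_adj] at hij
      obtain ⟨hij, -⟩ := hij
      simp only [Set.mem_insert_iff, Set.mem_singleton_iff, Sym2.eq_iff] at hij
      rcases hij with h | h | h | h | h | h <;> obtain ⟨rfl, rfl⟩ | ⟨rfl, rfl⟩ := h <;>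
        simp [a, b, c, a', b', c', a.symm, b.symm, c.symm, a'.symm, b'.symm, c'.symm]
    · intro i j hij
      have := a.ne
      have := b.ne
      have := c.ne
      have := a'.ne
      have := b'.ne
      have := c'.ne
      fin_cases i <;> fin_cases j <;> simp at hij ⊢ <;> grind

end Copies

/-! ### Monotonicity of the arrow relation -/

theorem RamseyArrow.mono {U U' V W : Type*} {K : SimpleGraph U} {K' : SimpleGraph U'}
    {G : SimpleGraph V} {H : SimpleGraph W} (h : RamseyArrow K G H) (hK : K ⊑ K') :
    RamseyArrow K' G H := by
  obtain ⟨f⟩ := hK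
  intro R S hRS hdis
  -- The pulled-back colours are cut down to `K` because the copy of `K` in `K'` need not be
  -- induced.
  have hle : ∀ T : SimpleGraph U', T.comap f ⊓ K ⊑ T := fun T =>
    ⟨SimpleGraph.Hom.toCopy ⟨f, fun h => h.1⟩ f.injective⟩
  refine (h (R.comap f ⊓ K) (S.comap f ⊓ K) ?_ ?_).imp (fun h => h.trans (hle R))
    (fun h => h.trans (hle S))
  · ext a b
    have : K.Adj a b → R.Adj (f a) (f b) ∨ S.Adj (f a) (f b) := fun hab => by
      rw [← SimpleGraph.sup_adj, hRS]
      exact f.toHom.map_adj hab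
    simp only [SimpleGraph.sup_adj, SimpleGraph.inf_adj, SimpleGraph.comap_adj]
    tauto
  · rw [disjoint_iff] at hdis ⊢
    ext a b
    have : ¬ (R ⊓ S).Adj (f a) (f b) := by simp [hdis]
    simp only [SimpleGraph.inf_adj, SimpleGraph.comap_adj, SimpleGraph.bot_adj] at this ⊢
    tauto

theorem completeEquipartiteGraph_isContained {j j' s s' : ℕ} (hj : j ≤ j') (hs : s ≤ s') :
    SimpleGraph.completeEquipartiteGraph j s ⊑ SimpleGraph.completeEquipartiteGraph j' s' :=
  ⟨SimpleGraph.Hom.toCopy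
    ⟨Prod.map (Fin.castLE hj) (Fin.castLE hs), fun {a b} h => by
      rw [SimpleGraph.completeEquipartiteGraph_adj] at h ⊢
      exact (Fin.castLE_injective hj).ne h⟩
    ((Fin.castLE_injective hj).prodMap (Fin.castLE_injective hs))⟩

/-! ### Sorting the neighbours of a vertex -/

/-- The columns of a family of predicates on `Fin s` can be permuted such that each predicate
holds on an initial segment, and the rows other than the first one such that these segments
get shorter. -/
theorem exists_perm_sorted {j s : ℕ} [NeZero j] (f : Fin j → Fin s → Prop) :
    ∃ (π : Equiv.Perm (Fin j)) (σ : Fin j → Equiv.Perm (Fin s)), π 0 = 0 ∧ σ 0 = 1 ∧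
      (∀ i k k', i ≠ 0 → k ≤ k' → f (π i) (σ i k') → f (π i) (σ i k)) ∧
      ∀ i i' k, i ≠ 0 → i ≤ i' → f (π i') (σ i' k) → f (π i) (σ i k) := by
  classical
  let g (i : Fin j) (k : Fin s) : ℕ := if f i k then 0 else 1
  let c (i : Fin j) : ℕ := (Finset.univ.filter fun k => f i k).card
  -- As `c i ≤ s`, the other keys are positive, so row `0` stays first and the rest follow by
  -- decreasing `c`.
  let key (i : Fin j) : ℕ := if i = 0 then 0 else s + 1 - c i
  let π := Tuple.sort key
  let σ (i : Fin j) : Equiv.Perm (Fin s) := if i = 0 then 1 else Tuple.sort (g (π i))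
  have hc : ∀ i, c i ≤ s := fun i => (Finset.card_le_univ _).trans (by simp)
  have hmono : Monotone (key ∘ π) := Tuple.monotone_sort key
  have hπ : π 0 = 0 := by
    by_contra hne
    have h := hmono (Fin.zero_le (π.symm 0))
    simp only [Function.comp_apply, Equiv.apply_symm_apply] at h
    have h₀ : key 0 = 0 := by simp [key]
    have h₁ : key (π 0) = s + 1 - c (π 0) := by simp [key, hne]
    have := hc (π 0)
    omega
  have hrow : ∀ i k k', i ≠ 0 → k ≤ k' → f (π i) (σ i k') → f (π i) (σ i k) := by
    intro i k k' hi hk h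
    by_contra hcon
    have := Tuple.monotone_sort (g (π i)) hk
    simp only [σ, if_neg hi] at h hcon
    simp [g, h, hcon] at this
  refine ⟨π, σ, hπ, by simp [σ], hrow, ?_⟩
  intro i i' k hi hii' h
  by_contra hcon
  have hi' : i' ≠ 0 := by
    rintro rfl
    exact hi (le_antisymm hii' (Fin.zero_le _))
  have hne : ∀ a, a ≠ 0 → π a ≠ 0 := fun a ha h => ha (π.injective (h.trans hπ.symm))
  have hkey := hmono hii'
  simp only [Function.comp_apply, key, if_neg (hne i hi), if_neg (hne i' hi')] at hkey
  have hcard : ∀ a, (Finset.univ.filter fun k => f (π a) (σ a k)).card = c (π a) := fun a =>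
    Finset.card_bij (fun k _ => σ a k) (by simp) (fun _ _ _ _ h => (σ a).injective h)
      (fun b hb => ⟨(σ a).symm b, by simpa using hb, by simp⟩)
  -- Two initial segments are nested; `k` lies only in the one of `i'`, which is thus strictly
  -- longer, against the sorting.
  have hlt : c (π i) < c (π i') := by
    rw [← hcard i, ← hcard i']
    refine Finset.card_lt_card ((Finset.ssubset_iff_of_subset ?_).2 ⟨k, by simpa, by simpa⟩)
    intro k' hk'
    simp only [Finset.mem_filter, Finset.mem_univ, true_and] at hk' ⊢
    exact hrow i' k' k hi' (not_lt.1 fun hlt => hcon (hrow i k k' hi hlt.le hk')) h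
  have := hc (π i')
  omega

/-! ### Upper bounds from the search -/

/-- A good colouring is relabelled by the part-preserving bijection `φ`, which fixes `(0, 0)` and
sorts its blue neighbours, and is then read on the numbers `s * i + k`. -/
theorem ramseyArrow_of_colouringRefuted {j s d : ℕ} {es : List (ℕ × ℕ)} (hj : 0 < j) (hs : 0 < s)
    (hes : ∀ e ∈ es, e.1 < j * s ∧ e.2 < j * s ∧ e.1 / s ≠ e.2 / s)
    (href : colouringRefuted es (j * s) s d = true) :
    RamseyArrow (SimpleGraph.completeEquipartiteGraph j s) butterflyGraph
      (SimpleGraph.cycleGraph 4) := by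
  have : NeZero j := ⟨hj.ne'⟩
  have : NeZero s := ⟨hs.ne'⟩
  intro R S hRS hdis
  by_contra hcon
  rw [butterflyGraph_isContained_iff, cycleGraph_four_isContained_iff, not_or] at hcon
  obtain ⟨hR, hS⟩ := hcon
  have hadj : ∀ a b : Fin j × Fin s, R.Adj a b ∨ S.Adj a b ↔ a.1 ≠ b.1 := fun a b => by
    rw [← SimpleGraph.sup_adj, hRS, SimpleGraph.completeEquipartiteGraph_adj]
  obtain ⟨π, σ, hπ, hσ, hrow, hpart⟩ := exists_perm_sorted fun i k => S.Adj (0, 0) (i, k)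
  let φ : Fin j × Fin s ≃ Fin j × Fin s := Equiv.prodShear π σ
  have hφ : ∀ a, φ a = (π a.1, σ a.1 a.2) := fun _ => rfl
  have hφ₀ : φ (0, 0) = (0, 0) := by simp [hφ, hπ, hσ]
  let dec (u : Fin (j * s)) : Fin j × Fin s := finProdFinEquiv.symm u
  have hdec : ∀ u, dec u = (u.divNat, u.modNat) := fun _ => rfl
  have hinj : Function.Injective fun u => φ (dec u) :=
    φ.injective.comp finProdFinEquiv.symm.injective
  let lift (T : SimpleGraph (Fin j × Fin s)) (u v : ℕ) : Prop :=
    ∃ (hu : u < j * s) (hv : v < j * s), T.Adj (φ (dec ⟨u, hu⟩)) (φ (dec ⟨v, hv⟩))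
  have hne : ∀ {u v : ℕ} {hu : u < j * s} {hv : v < j * s}, u ≠ v →
      φ (dec ⟨u, hu⟩) ≠ φ (dec ⟨v, hv⟩) := fun h => hinj.ne (by simpa using h)
  have hsymm : ∀ T u v, lift T u v → lift T v u := fun T u v ⟨hu, hv, h⟩ => ⟨hv, hu, h.symm⟩
  have hpos : 0 < j * s := Nat.mul_pos hj hs
  have hdec₀ : dec ⟨0, hpos⟩ = (0, 0) := by
    rw [hdec]
    ext <;> simp [Fin.divNat, Fin.modNat]
  have hnot : ∀ a b, R.Adj a b → ¬ S.Adj a b := fun a b h h' => by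
    have : (R ⊓ S).Adj a b := ⟨h, h'⟩
    rw [disjoint_iff.1 hdis] at this
    exact this
  refine false_of_colouringRefuted (red := lift R) (blue := lift S) href (hsymm R) (hsymm S)
    ?_ ?_ ?_ ?_ ?_
  · intro e he
    obtain ⟨h₁, h₂, h₃⟩ := hes e he
    have := (hadj (φ (dec ⟨e.1, h₁⟩)) (φ (dec ⟨e.2, h₂⟩))).2 (by
      rw [hφ, hφ]
      refine π.injective.ne fun h => h₃ ?_
      simpa [hdec, Fin.ext_iff] using h)
    exact this.imp (fun h => ⟨h₁, h₂, h⟩) (fun h => ⟨h₁, h₂, h⟩)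
  · rintro x y z w hxz hyw ⟨_, _, h₁⟩ ⟨_, _, h₂⟩ ⟨_, _, h₃⟩ ⟨_, _, h₄⟩
    exact hS ⟨_, _, _, _, hne hxz, hne hyw, h₁, h₂, h₃, h₄⟩
  · rintro x y z y' z' n₁ n₂ n₃ n₄ ⟨_, _, h₁⟩ ⟨_, _, h₂⟩ ⟨_, _, h₃⟩ ⟨_, _, h₄⟩ ⟨_, _, h₅⟩
      ⟨_, _, h₆⟩
    exact hR ⟨_, _, _, _, _, hne n₁, hne n₂, hne n₃, hne n₄, h₁, h₂, h₃, h₄, h₅, h₆⟩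
  · rintro x hx hmod ⟨_, hx₁, h₁⟩ ⟨_, hx₂, h₂⟩
    rw [hdec₀, hφ₀] at h₁ h₂
    refine hnot _ _ h₁ ?_
    -- As `s` does not divide `x + 1`, the vertices `x` and `x + 1` lie in the same part.
    have hdiv : (x + 1) / s = x / s :=
      Nat.succ_div_of_not_dvd fun h => hmod (Nat.mod_eq_zero_of_dvd h)
    have e₁ : (dec ⟨x + 1, hx₂⟩).1 = (dec ⟨x, hx₁⟩).1 := by simp [hdec, Fin.ext_iff, hdiv]
    have hle : (dec ⟨x, hx₁⟩).2 ≤ (dec ⟨x + 1, hx₂⟩).2 := by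
      have a := Nat.div_add_mod x s
      have b := Nat.div_add_mod (x + 1) s
      rw [hdiv] at b
      simp only [hdec, Fin.le_def, Fin.coe_modNat]
      omega
    refine hrow _ _ _ ?_ hle ?_
    · intro h
      have : x / s = 0 := by simpa [hdec, Fin.ext_iff] using h
      have := Nat.div_pos hx hs
      omega
    · rw [hφ, e₁] at h₂
      exact h₂
  · rintro x hx hlt ⟨_, hx₁, h₁⟩ ⟨_, hx₂, h₂⟩
    rw [hdec₀, hφ₀] at h₁ h₂
    refine hnot _ _ h₁ ?_
    have hle : (dec ⟨x, hx₁⟩).1 ≤ (dec ⟨x + s, hx₂⟩).1 := by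
      simp only [hdec, Fin.le_def, Fin.coe_divNat]
      exact Nat.div_le_div_right (by omega)
    have e₂ : (dec ⟨x + s, hx₂⟩).2 = (dec ⟨x, hx₁⟩).2 := by simp [hdec, Fin.ext_iff]
    refine hpart _ (dec ⟨x + s, hx₂⟩).1 _ ?_ hle ?_
    · intro h
      have : x / s = 0 := by simpa [hdec, Fin.ext_iff] using h
      have := Nat.div_pos hx hs
      omega
    · rw [hφ, e₂] at h₂
      exact h₂

/-- The edges of `K_{7 × 1}`, in the order in which they are coloured. -/
def sevenOneEdges : List (ℕ × ℕ) :=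
  [(0, 4), (0, 3), (0, 2), (0, 5), (0, 1), (0, 6), (1, 5), (2, 5), (3, 5), (4, 5), (1, 3), (2, 3),
   (1, 2), (3, 4), (1, 4), (2, 4), (5, 6), (4, 6), (3, 6), (1, 6), (2, 6)]

/-- The final argument is the least `d` with `2 ^ d` at least the number of edges: 21 here, then 40,
54 and 48. -/
theorem sevenOne_refuted : colouringRefuted sevenOneEdges 7 1 5 = true := by decide +kernel

/-- The edges of `K_{5 × 2}`, in the order in which they are coloured. -/
def fiveTwoEdges : List (ℕ × ℕ) :=
  [(0, 9), (0, 7), (0, 6), (0, 4), (0, 2), (0, 8), (2, 9), (4, 9), (6, 9), (2, 6), (4, 6), (2, 4),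
   (7, 9), (4, 7), (2, 7), (7, 8), (6, 8), (4, 8), (2, 8), (0, 5), (5, 7), (5, 6), (2, 5), (5, 8),
   (5, 9), (1, 6), (1, 4), (1, 2), (1, 7), (1, 5), (1, 8), (3, 9), (3, 7), (3, 6), (0, 3), (3, 4),
   (3, 5), (1, 9), (3, 8), (1, 3)]

theorem fiveTwo_refuted : colouringRefuted fiveTwoEdges 10 2 6 = true := by decide +kernel

/-- The edges of `K_{4 × 3}`, in the order in which they are coloured. -/
def fourThreeEdges : List (ℕ × ℕ) :=
  [(0, 3), (0, 4), (0, 7), (0, 8), (0, 11), (3, 8), (4, 8), (4, 7), (3, 7), (8, 11), (7, 11),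
   (3, 11), (4, 11), (3, 9), (7, 9), (4, 9), (8, 9), (0, 9), (0, 6), (6, 9), (6, 11), (4, 6),
   (3, 6), (0, 5), (5, 7), (5, 8), (5, 9), (5, 11), (5, 6), (2, 3), (2, 6), (2, 9), (2, 4),
   (2, 11), (2, 7), (2, 8), (0, 10), (8, 10), (7, 10), (1, 11), (1, 10), (3, 10), (6, 10), (1, 7),
   (1, 9), (1, 5), (1, 4), (2, 10), (1, 3), (1, 6), (2, 5), (1, 8), (4, 10), (5, 10)]

theorem fourThree_refuted : colouringRefuted fourThreeEdges 12 3 6 = true := by decide +kernel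

/-- The edges of `K_{3 × 4}`, in the order in which they are coloured. -/
def threeFourEdges : List (ℕ × ℕ) :=
  [(0, 10), (0, 9), (0, 11), (0, 5), (0, 4), (0, 6), (5, 9), (4, 9), (6, 9), (5, 11), (4, 11),
   (6, 11), (3, 9), (3, 5), (3, 4), (3, 11), (3, 6), (2, 5), (2, 4), (2, 9), (2, 11), (2, 6),
   (6, 10), (5, 10), (2, 10), (3, 10), (4, 10), (0, 7), (7, 10), (7, 11), (7, 9), (2, 7), (3, 7),
   (2, 8), (7, 8), (3, 8), (6, 8), (5, 8), (4, 8), (0, 8), (1, 5), (1, 11), (1, 9), (1, 10),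
   (1, 4), (1, 7), (1, 8), (1, 6)]

theorem threeFour_refuted : colouringRefuted threeFourEdges 12 4 6 = true := by decide +kernel

theorem ramseyArrow_completeEquipartiteGraph_seven_one : RamseyArrow
    (SimpleGraph.completeEquipartiteGraph 7 1) butterflyGraph (SimpleGraph.cycleGraph 4) :=
  ramseyArrow_of_colouringRefuted (by norm_num) (by norm_num) (by decide +kernel) sevenOne_refuted

theorem ramseyArrow_completeEquipartiteGraph_five_two : RamseyArrow
    (SimpleGraph.completeEquipartiteGraph 5 2) butterflyGraph (SimpleGraph.cycleGraph 4) :=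
  ramseyArrow_of_colouringRefuted (by norm_num) (by norm_num) (by decide +kernel) fiveTwo_refuted

theorem ramseyArrow_completeEquipartiteGraph_four_three : RamseyArrow
    (SimpleGraph.completeEquipartiteGraph 4 3) butterflyGraph (SimpleGraph.cycleGraph 4) :=
  ramseyArrow_of_colouringRefuted (by norm_num) (by norm_num) (by decide +kernel)
    fourThree_refuted

theorem ramseyArrow_completeEquipartiteGraph_three_four : RamseyArrow
    (SimpleGraph.completeEquipartiteGraph 3 4) butterflyGraph (SimpleGraph.cycleGraph 4) :=
  ramseyArrow_of_colouringRefuted (by norm_num) (by norm_num) (by decide +kernel)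
    threeFour_refuted

/-! ### Lower bounds -/

/-- A set of blue edges of a complete equipartite graph without blue four-cycle, such that the
other edges form no butterfly, shows that the arrow relation fails. -/
theorem not_ramseyArrow_of_blue {j s : ℕ} (blue : Fin j × Fin s → Fin j × Fin s → Bool)
    (hsymm : ∀ a b, blue a b = true → blue b a = true)
    (hle : ∀ a b, blue a b = true → a.1 ≠ b.1)
    -- Conditions are interleaved with quantifiers so that evaluation prunes early.
    (hcycle : ∀ x z, x ≠ z → ∀ y, blue x y = true ∧ blue y z = true →
      ∀ w, blue x w = true ∧ blue w z = true → y = w)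
    (hbutterfly : ∀ x y, x.1 ≠ y.1 ∧ blue x y = false → ∀ z, x.1 ≠ z.1 ∧ blue x z = false →
      y.1 ≠ z.1 ∧ blue y z = false → ∀ y', x.1 ≠ y'.1 ∧ blue x y' = false → y ≠ y' ∧ z ≠ y' →
      ∀ z', x.1 ≠ z'.1 ∧ blue x z' = false → y'.1 ≠ z'.1 ∧ blue y' z' = false →
      y = z' ∨ z = z') :
    ¬ RamseyArrow (SimpleGraph.completeEquipartiteGraph j s) butterflyGraph
      (SimpleGraph.cycleGraph 4) := by
  have hcomm : ∀ a b, blue a b = false → blue b a = false := fun a b h => by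
    by_contra hb
    simp [hsymm b a (by simpa using hb)] at h
  let S : SimpleGraph (Fin j × Fin s) :=
    { Adj := fun a b => blue a b = true
      symm := ⟨hsymm⟩
      loopless := ⟨fun a h => hle a a h rfl⟩ }
  let R : SimpleGraph (Fin j × Fin s) :=
    { Adj := fun a b => a.1 ≠ b.1 ∧ blue a b = false
      symm := ⟨fun a b h => ⟨h.1.symm, hcomm a b h.2⟩⟩
      loopless := ⟨fun a h => h.1 rfl⟩ }
  intro h
  have hsup : R ⊔ S = SimpleGraph.completeEquipartiteGraph j s := by
    ext a b
    rw [SimpleGraph.sup_adj, SimpleGraph.completeEquipartiteGraph_adj]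
    refine ⟨fun h => h.elim And.left (hle a b), fun hab => ?_⟩
    cases hb : blue a b with
    | false => exact Or.inl ⟨hab, hb⟩
    | true => exact Or.inr hb
  have hdis : Disjoint R S := by
    rw [disjoint_iff]
    ext a b
    exact iff_of_false (fun ⟨⟨_, h₁⟩, (h₂ : blue a b = true)⟩ => by simp [h₁] at h₂) id
  rcases h R S hsup hdis with h | h
  · obtain ⟨x, y, z, y', z', h₁, h₂, h₃, h₄, a, b, c, a', b', c'⟩ :=
      butterflyGraph_isContained_iff.1 h
    exact (hbutterfly x y a z b c y' a' ⟨h₁, h₃⟩ z' b' c').elim h₂ h₄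
  · obtain ⟨x, y, z, w, hxz, hyw, h₁, h₂, h₃, h₄⟩ := cycleGraph_four_isContained_iff.1 h
    exact hyw (hcycle x z hxz y ⟨h₁, h₂⟩ w ⟨h₃, h₄⟩)

/-- The symmetric relation on `Fin j × Fin s` given by the edges `es` between the numbers
`s * i + k` of the pairs `(i, k)`. -/
def edgeListRel {j s : ℕ} (es : List (ℕ × ℕ)) (a b : Fin j × Fin s) : Bool :=
  es.any fun e => Nat.beq e.1 (s * a.1 + a.2) && Nat.beq e.2 (s * b.1 + b.2) ||
    Nat.beq e.1 (s * b.1 + b.2) && Nat.beq e.2 (s * a.1 + a.2)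

/-- The red triangles are `037`, `057` and `246`: the first two share an edge and the third is
disjoint from both. -/
theorem not_ramseyArrow_completeEquipartiteGraph_three_three : ¬ RamseyArrow
    (SimpleGraph.completeEquipartiteGraph 3 3) butterflyGraph (SimpleGraph.cycleGraph 4) :=
  not_ramseyArrow_of_blue (edgeListRel [(0, 4), (0, 6), (0, 8), (1, 3), (1, 4), (1, 5), (2, 5),
    (2, 7), (2, 8), (3, 6)]) (by decide +kernel) (by decide +kernel) (by decide +kernel)
    (by decide +kernel)

/-- The red triangles are `124`, `146` and `057`: again two on a common edge and one disjoint from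
both. -/
theorem not_ramseyArrow_completeEquipartiteGraph_four_two : ¬ RamseyArrow
    (SimpleGraph.completeEquipartiteGraph 4 2) butterflyGraph (SimpleGraph.cycleGraph 4) :=
  not_ramseyArrow_of_blue (edgeListRel [(0, 2), (0, 3), (0, 4), (0, 6), (1, 3), (1, 5), (1, 7),
    (2, 6), (2, 7), (3, 4), (3, 5)]) (by decide +kernel) (by decide +kernel) (by decide +kernel)
    (by decide +kernel)

/-- Blue is two disjoint triangles, so red is the bipartite graph `K_{3,3}`. -/
theorem not_ramseyArrow_completeEquipartiteGraph_six_one : ¬ RamseyArrow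
    (SimpleGraph.completeEquipartiteGraph 6 1) butterflyGraph (SimpleGraph.cycleGraph 4) :=
  not_ramseyArrow_of_blue (edgeListRel [(0, 1), (0, 2), (1, 2), (3, 4), (3, 5), (4, 5)])
    (by decide +kernel) (by decide +kernel) (by decide +kernel) (by decide +kernel)

/-! ### The Ramsey numbers -/

theorem isSizeMultipartiteRamsey_of_arrow {V W : Type*} {G : SimpleGraph V} {H : SimpleGraph W}
    {j j₁ j₂ m : ℕ} (h₁ : j₁ ≤ j)
    (harrow : RamseyArrow (SimpleGraph.completeEquipartiteGraph j₁ (m + 1)) G H) (h₂ : j ≤ j₂)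
    (hnot : ¬ RamseyArrow (SimpleGraph.completeEquipartiteGraph j₂ m) G H) :
    IsSizeMultipartiteRamsey j G H (m + 1) := by
  refine ⟨⟨m.succ_pos, harrow.mono (completeEquipartiteGraph_isContained h₁ le_rfl)⟩, ?_⟩
  rintro s ⟨-, hs⟩
  by_contra hlt
  exact hnot (hs.mono (completeEquipartiteGraph_isContained h₂ (by omega)))

theorem theorem3p9 (j : ℕ) (hj : 3 ≤ j) :
    IsSizeMultipartiteRamsey j butterflyGraph (SimpleGraph.cycleGraph 4)
      (if j = 3 then 4 else if j = 4 then 3 else if j = 5 ∨ j = 6 then 2 else 1) := by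
  split_ifs with h₃ h₄ h₅
  · exact isSizeMultipartiteRamsey_of_arrow h₃.ge ramseyArrow_completeEquipartiteGraph_three_four
      h₃.le not_ramseyArrow_completeEquipartiteGraph_three_three
  · exact isSizeMultipartiteRamsey_of_arrow h₄.ge ramseyArrow_completeEquipartiteGraph_four_three
      h₄.le not_ramseyArrow_completeEquipartiteGraph_four_two
  -- `K_{5×2}` from below and `K_{6×1}` from above settle both `j = 5` and `j = 6`.
  · exact isSizeMultipartiteRamsey_of_arrow (by omega)
      ramseyArrow_completeEquipartiteGraph_five_two (by omega)
      not_ramseyArrow_completeEquipartiteGraph_six_one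
  · exact ⟨⟨Nat.one_pos, ramseyArrow_completeEquipartiteGraph_seven_one.mono
      (completeEquipartiteGraph_isContained (by omega) le_rfl)⟩, fun s hs => hs.1⟩
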